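/- Let $\mathbb K$ be the field of real or of complex scalars. A Banach space $Y$ over $\mathbb K$ is called an \emph{almost isometric copy of $\ell^1$} if it has a Schauder basis $(x_n)_{n\ge 1}$ for which there is a sequence $(\delta_m)$ in $[0,1)$ tending to $0$ such that $$(1-\delta_m)\sum_{n=m}^{\infty}|\alpha_n|\le\Bigl\|\sum_{n=m}^{\infty}\alpha_n x_n\Bigr\|\le\sum_{n=m}^{\infty}|\alpha_n|$$ for all $m$ and all absolutely summable scalar sequences $(\alpha_n)$; it is called an \emph{almost isometric copy of $c_0$} if it has a Schauder basis $(x_n)_{n\ge 1}$ for which there is a sequence $(\delta_m)$ in $[0,1)$ tending to $0$ such that $$(1-\delta_m)\sup_{m\le n\le m'}|\alpha_n|\le\Bigl\|\sum_{n=m}^{m'}\alpha_n x_n\Bigr\|\le(1+\delta_m)\sup_{m\le n\le m'}|\alpha_n|$$ for all $m\le m'$ and all scalars $\alpha_n$. A linear projection $P$ on a Banach space $X$ is an \emph{L-projection} if $\|x\|=\|Px\|+\|x-Px\|$ for all $x\in X$. A Banach space $Y$, regarded as a subspace of its bidual $Y''$ through the canonical embedding, is \emph{L-embedded} if it is the range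 of an L-projection on $Y''$, and \emph{M-embedded} if it is an M-ideal in $Y''$, that is, if its annihilator $Y^{\perp}\subset Y'''$ is the range of an L-projection on $Y'''$. Then: (i) there is an almost isometric copy of $\ell^1$ over $\mathbb K$ that is not L-embedded; (ii) there is an almost isometric copy of $c_0$ over $\mathbb K$ that is not M-embedded. -/

import Mathlib

set_option maxSynthPendingDepth 3

open Filter Topology

universe u

section Spanning

variable (𝕜 : Type*) {X : Type*} [RCLike 𝕜] [NormedAddCommGroup X] [NormedSpace 𝕜 X]

/-- The sequence `(x n)` of nonzero vectors spans `ℓ¹` almost isometrically: there are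
`δ m ∈ [0, 1)` tending to `0` such that, for every `m` and all absolutely summable scalars,
`(1 - δ m) ∑_{n ≥ m} |α n| ≤ ‖∑_{n ≥ m} α n • x n‖ ≤ ∑_{n ≥ m} |α n|`. -/
def SpansL1AlmostIsometrically (x : ℕ → X) : Prop :=
  (∀ n, x n ≠ 0) ∧
  ∃ δ : ℕ → ℝ, (∀ m, δ m ∈ Set.Ico (0 : ℝ) 1) ∧ Tendsto δ atTop (𝓝 0) ∧
    ∀ (α : ℕ → 𝕜), Summable (fun n => ‖α n‖) → ∀ m : ℕ,
      (1 - δ m) * (∑' n, ‖α (m + n)‖) ≤ ‖∑' n, α (m + n) • x (m + n)‖ ∧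
      ‖∑' n, α (m + n) • x (m + n)‖ ≤ ∑' n, ‖α (m + n)‖

/-- The sequence `(x n)` of nonzero vectors spans `c₀` almost isometrically: there are
`δ m ∈ [0, 1)` tending to `0` such that, for all `m ≤ m'` and all scalars,
`(1 - δ m) sup_{m ≤ n ≤ m'} |α n| ≤ ‖∑_{n=m}^{m'} α n • x n‖
  ≤ (1 + δ m) sup_{m ≤ n ≤ m'} |α n|`. -/
def SpansC0AlmostIsometrically (x : ℕ → X) : Prop :=
  (∀ n, x n ≠ 0) ∧
  ∃ δ : ℕ → ℝ, (∀ m, δ m ∈ Set.Ico (0 : ℝ) 1) ∧ Tendsto δ atTop (𝓝 0) ∧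
    ∀ (α : ℕ → 𝕜) (m m' : ℕ) (h : m ≤ m'),
      (1 - δ m) * (Finset.Icc m m').sup' (Finset.nonempty_Icc.mpr h) (fun n => ‖α n‖)
        ≤ ‖∑ n ∈ Finset.Icc m m', α n • x n‖ ∧
      ‖∑ n ∈ Finset.Icc m m', α n • x n‖
        ≤ (1 + δ m) * (Finset.Icc m m').sup' (Finset.nonempty_Icc.mpr h) (fun n => ‖α n‖)

end Spanning

section Spaces

variable (𝕜 : Type*) (X : Type*) [RCLike 𝕜] [NormedAddCommGroup X] [NormedSpace 𝕜 X]

/-- `X` is almost isometric to `ℓ¹` (is an almost isometric copy of `ℓ¹`): it has a Schauder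
basis that spans `ℓ¹` almost isometrically. -/
def IsAlmostIsometricToL1 : Prop :=
  ∃ b : SchauderBasis 𝕜 X, SpansL1AlmostIsometrically 𝕜 (fun n => b n)

/-- `X` is almost isometric to `c₀` (is an almost isometric copy of `c₀`): it has a Schauder
basis that spans `c₀` almost isometrically. -/
def IsAlmostIsometricToC0 : Prop :=
  ∃ b : SchauderBasis 𝕜 X, SpansC0AlmostIsometrically 𝕜 (fun n => b n)

variable {X}

/-- The subspace `Y` of `X` is an L-summand in `X`: it is the range of an L-projection on `X`. -/
def IsLSummand (Y : Submodule 𝕜 X) : Prop :=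
  ∃ P : X →L[𝕜] X, IsLprojection X P ∧ P.toLinearMap.range = Y

/-- The subspace `Y` of `X` is an M-ideal in `X`: its annihilator
`{f ∈ X' | ∀ y ∈ Y, f y = 0}` is the range of an L-projection on the dual `X'`. -/
def IsMIdeal (Y : Submodule 𝕜 X) : Prop :=
  IsLSummand 𝕜 (StrongDual.polarSubmodule 𝕜 Y)

variable (X)

/-- The canonical copy of `X` in its bidual. -/
noncomputable def canonicalCopy : Submodule 𝕜 (StrongDual 𝕜 (StrongDual 𝕜 X)) :=
  (NormedSpace.inclusionInDoubleDual 𝕜 X).toLinearMap.range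

/-- `X` is L-embedded: (the canonical copy of) `X` is an L-summand in the bidual `X''`. -/
def IsLEmbedded : Prop :=
  IsLSummand 𝕜 (X := StrongDual 𝕜 (StrongDual 𝕜 X)) (canonicalCopy 𝕜 X)

/-- `X` is M-embedded: (the canonical copy of) `X` is an M-ideal in the bidual `X''`. -/
def IsMEmbedded : Prop :=
  IsMIdeal 𝕜 (X := StrongDual 𝕜 (StrongDual 𝕜 X)) (canonicalCopy 𝕜 X)

end Spaces

/-! The definitions control a basis only asymptotically, so the norm may be changed in one
direction. The examples are `𝕜 ⊕_∞ ℓ¹` and `𝕜 ⊕₁ c₀`: one line is attached to the classical space by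
the wrong kind of sum.

Both rest on the incompatibility of L- and M-projections: if the range of an L-projection contains
that of a nonzero M-projection, it is the identity; if it lies in the kernel of one, it is zero.
Transposition exchanges the two types. Let `Q` be the rank-one projection onto the added line; its
bitranspose `Q''` still maps into `Y`. On `𝕜 ⊕_∞ ℓ¹`, `Q''` is an M-projection, so an L-projection
onto `Y` would be the identity of `Y''`. On `𝕜 ⊕₁ c₀`, `Q'''` is an M-projection vanishing on the
annihilator of `Y`, so an L-projection onto that annihilator would be zero. Either way `Y = Y''`,
although neither space is reflexive. -/

/-! ### L- and M-projections and their transposes -/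

section Projections

variable {𝕜 X : Type*} [RCLike 𝕜] [NormedAddCommGroup X] [NormedSpace 𝕜 X]

/-- The transpose of a continuous endomorphism. -/
noncomputable def ContinuousLinearMap.transpose (Q : X →L[𝕜] X) :
    StrongDual 𝕜 X →L[𝕜] StrongDual 𝕜 X :=
  (ContinuousLinearMap.compL 𝕜 X X 𝕜).flip Q

@[simp]
theorem ContinuousLinearMap.transpose_apply (Q : X →L[𝕜] X) (f : StrongDual 𝕜 X) (x : X) :
    Q.transpose f x = f (Q x) := rfl

theorem isLprojection_iff (Q : X →L[𝕜] X) :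
    IsLprojection X Q ↔ (∀ x, Q (Q x) = Q x) ∧ ∀ x, ‖x‖ = ‖Q x‖ + ‖x - Q x‖ :=
  ⟨fun h => ⟨fun x => DFunLike.congr_fun h.proj x, h.Lnorm⟩,
    fun h => ⟨ContinuousLinearMap.ext h.1, h.2⟩⟩

theorem isMprojection_iff (Q : X →L[𝕜] X) :
    IsMprojection X Q ↔ (∀ x, Q (Q x) = Q x) ∧ ∀ x, ‖x‖ = max ‖Q x‖ ‖x - Q x‖ :=
  ⟨fun h => ⟨fun x => DFunLike.congr_fun h.proj x, h.Mnorm⟩,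
    fun h => ⟨ContinuousLinearMap.ext h.1, h.2⟩⟩

/-- A scalar of modulus at most one that rotates `z` onto its modulus. -/
theorem exists_norm_le_one_mul_eq_norm (z : 𝕜) : ∃ c : 𝕜, ‖c‖ ≤ 1 ∧ c * z = (‖z‖ : 𝕜) := by
  rcases eq_or_ne z 0 with rfl | hz
  · exact ⟨0, by simp, by simp⟩
  · refine ⟨‖z‖ / z, ?_, div_mul_cancel₀ _ hz⟩
    simp [div_self (norm_ne_zero_iff.2 hz)]

/-- The transpose of an M-projection is an L-projection. -/
theorem IsMprojection.transpose {Q : X →L[𝕜] X} (hQ : IsMprojection X Q) :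
    IsLprojection (StrongDual 𝕜 X) Q.transpose := by
  obtain ⟨hi, hn⟩ := (isMprojection_iff Q).1 hQ
  refine (isLprojection_iff _).2 ⟨fun f => ?_, fun f => le_antisymm ?_ ?_⟩
  · ext x; simp [hi]
  · simpa using norm_add_le (Q.transpose f) (f - Q.transpose f)
  · by_contra! hlt
    -- The thresholds are chosen so that the values at `x` and `y` have moduli adding up to more
    -- than `‖f‖`; the M-norm lets the two vectors be glued into one `u` of norm at most one.
    obtain ⟨x, hx, hxr⟩ := (Q.transpose f).exists_lt_apply_of_lt_opNorm
      (r := ‖f‖ - ‖f - Q.transpose f‖) (by linarith)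
    obtain ⟨y, hy, hyr⟩ := (f - Q.transpose f).exists_lt_apply_of_lt_opNorm
      (r := ‖f‖ - ‖Q.transpose f x‖) (by linarith)
    obtain ⟨c, hc, hcx⟩ := exists_norm_le_one_mul_eq_norm (Q.transpose f x)
    obtain ⟨d, hd, hdy⟩ := exists_norm_le_one_mul_eq_norm ((f - Q.transpose f) y)
    set u := c • Q x + d • (y - Q y) with hu
    have hu1 : ‖u‖ ≤ 1 := by
      have e1 : Q u = c • Q x := by simp [hu, hi]
      rw [hn u, e1, hu, add_sub_cancel_left, norm_smul, norm_smul]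
      refine max_le (mul_le_one₀ hc (norm_nonneg _) ?_) (mul_le_one₀ hd (norm_nonneg _) ?_)
      · exact ((le_max_left _ _).trans (hn x).ge).trans hx.le
      · exact ((le_max_right _ _).trans (hn y).ge).trans hy.le
    have hfu : f u = ((‖Q.transpose f x‖ + ‖(f - Q.transpose f) y‖ : ℝ) : 𝕜) := by
      rw [RCLike.ofReal_add, ← hcx, ← hdy, hu]; simp
    have h := f.unit_le_opNorm u hu1
    rw [hfu, RCLike.norm_ofReal, abs_of_nonneg (by positivity)] at h
    linarith

/-- The transpose of an L-projection is an M-projection. -/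
theorem IsLprojection.transpose {Q : X →L[𝕜] X} (hQ : IsLprojection X Q) :
    IsMprojection (StrongDual 𝕜 X) Q.transpose := by
  obtain ⟨hi, hn⟩ := (isLprojection_iff Q).1 hQ
  refine (isMprojection_iff _).2 ⟨fun f => ?_, fun f => le_antisymm ?_ (max_le ?_ ?_)⟩
  · ext x; simp [hi]
  · refine f.opNorm_le_bound (by positivity) fun x => ?_
    have h1 := (Q.transpose f).le_opNorm (Q x)
    have h2 := (f - Q.transpose f).le_opNorm (x - Q x)
    have e : f x = Q.transpose f (Q x) + (f - Q.transpose f) (x - Q x) := by simp [hi]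
    calc ‖f x‖ ≤ ‖Q.transpose f‖ * ‖Q x‖ + ‖f - Q.transpose f‖ * ‖x - Q x‖ := by
          rw [e]; exact (norm_add_le _ _).trans (add_le_add h1 h2)
      _ ≤ max ‖Q.transpose f‖ ‖f - Q.transpose f‖ * ‖Q x‖ +
          max ‖Q.transpose f‖ ‖f - Q.transpose f‖ * ‖x - Q x‖ := by
          gcongr
          · exact le_max_left _ _
          · exact le_max_right _ _
      _ = _ := by rw [← mul_add, ← hn]
  · refine ContinuousLinearMap.opNorm_le_bound _ (norm_nonneg f) fun x => ?_
    refine (f.le_opNorm (Q x)).trans ?_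
    gcongr
    rw [hn x]; linarith [norm_nonneg (x - Q x)]
  · refine ContinuousLinearMap.opNorm_le_bound _ (norm_nonneg f) fun x => ?_
    rw [show (f - Q.transpose f) x = f (x - Q x) by simp]
    refine (f.le_opNorm _).trans ?_
    gcongr
    rw [hn x]; linarith [norm_nonneg (Q x)]

/-- An L-projection whose range contains the range of a nonzero M-projection is the identity. -/
theorem IsLprojection.eq_one_of_range_le {P Q : X →L[𝕜] X} (hP : IsLprojection X P)
    (hQ : IsMprojection X Q) (hPQ : ∀ x, P (Q x) = Q x) (hne : Q ≠ 0) : P = 1 := by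
  obtain ⟨hPi, hPn⟩ := (isLprojection_iff P).1 hP
  obtain ⟨hQi, hQn⟩ := (isMprojection_iff Q).1 hQ
  obtain ⟨e, he⟩ : ∃ e, Q e ≠ 0 := by
    by_contra! h; exact hne (ContinuousLinearMap.ext h)
  ext x
  set w := x - P x with hw
  have hPw : P w = 0 := by simp [hw, hPi]
  have key : ∀ y, ‖Q y + w‖ = ‖Q y‖ + ‖w‖ := fun y => by
    have := hPn (Q y + w)
    simpa [hPw, hPQ] using this
  -- With `y = -w`, additivity gives `‖w - Q w‖ = ‖Q w‖ + ‖w‖`, while the M-norm bounds the left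
  -- side by `‖w‖`.
  have hQw : Q w = 0 := by
    have h1 := key (-w)
    have h2 := hQn w
    have h3 := le_max_right ‖Q w‖ ‖w - Q w‖
    rw [map_neg, norm_neg, neg_add_eq_sub] at h1
    rw [← norm_le_zero_iff]; linarith
  have h4 := hQn (Q e + w)
  rw [key e, map_add, hQi, hQw, add_zero, add_sub_cancel_left] at h4
  have he' := norm_pos_iff.2 he
  have : ‖w‖ = 0 := by
    rcases max_cases ‖Q e‖ ‖w‖ with h | h <;> linarith [norm_nonneg w]
  have := norm_eq_zero.1 this
  exact (sub_eq_zero.1 this).symm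

/-- An L-projection whose range lies in the kernel of a nonzero M-projection is zero. -/
theorem IsLprojection.eq_zero_of_range_le_ker {P Q : X →L[𝕜] X} (hP : IsLprojection X P)
    (hQ : IsMprojection X Q) (hQP : ∀ x, Q (P x) = 0) (hne : Q ≠ 0) : P = 0 := by
  obtain ⟨hPi, hPn⟩ := (isLprojection_iff P).1 hP
  obtain ⟨hQi, hQn⟩ := (isMprojection_iff Q).1 hQ
  -- It suffices that `1 - P` fixes the range of `Q`, that is, `P (Q x) = 0`. Since `Q` kills `P (Q
  -- x)`, the M-norm gives `‖Q x - P (Q x)‖ ≥ ‖Q x‖`, leaving no room for `P (Q x)` in the L-norm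
  -- identity.
  have h := hP.Lcomplement.eq_one_of_range_le hQ (fun x => ?_) hne
  · simpa using h
  have h1 := hPn (Q x)
  have h2 := hQn (Q x - P (Q x))
  rw [map_sub, hQP, sub_zero, hQi] at h2
  have h3 := le_max_left ‖Q x‖ ‖Q x - P (Q x) - Q x‖
  have : P (Q x) = 0 := by rw [← norm_le_zero_iff]; linarith
  simp [this]

end Projections

/-! ### Obstructions to L- and M-embeddedness; limits in the bidual -/

section Bidual

variable {𝕜 Y : Type*} [RCLike 𝕜] [NormedAddCommGroup Y] [NormedSpace 𝕜 Y]

theorem ContinuousLinearMap.transpose_ne_zero {Q : Y →L[𝕜] Y} (h : Q ≠ 0) : Q.transpose ≠ 0 := by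
  obtain ⟨e, he⟩ : ∃ e, Q e ≠ 0 := by
    by_contra! h'; exact h (ContinuousLinearMap.ext h')
  obtain ⟨g, -, hg⟩ := exists_dual_vector 𝕜 (Q e) (norm_ne_zero_iff.2 he)
  intro h0
  have : Q.transpose g e = 0 := by rw [h0]; rfl
  rw [transpose_apply, hg] at this
  simp [he] at this

/-- The copy is an isometric image of a complete space. Closedness allows Hahn–Banach separation
from a point of the bidual outside it. -/
theorem isClosed_canonicalCopy [CompleteSpace Y] :
    IsClosed (canonicalCopy 𝕜 Y : Set (StrongDual 𝕜 (StrongDual 𝕜 Y))) := by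
  have := (NormedSpace.inclusionInDoubleDualLi (E := Y) 𝕜).isometry.isClosedEmbedding.isClosed_range
  exact this

/-- A proper closed subspace is annihilated by a nonzero functional. -/
theorem exists_dual_eq_zero_of_notMem (W : Submodule 𝕜 Y) (hW : IsClosed (W : Set Y)) {z : Y}
    (hz : z ∉ W) : ∃ f : StrongDual 𝕜 Y, (∀ y ∈ W, f y = 0) ∧ f z ≠ 0 := by
  have : IsClosed (W : Set Y) := hW
  have hne : (W.mkQ z) ≠ 0 := by simpa using hz
  obtain ⟨g, -, hg⟩ := exists_dual_vector 𝕜 (W.mkQ z) (norm_ne_zero_iff.2 hne)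
  refine ⟨g.comp W.mkQL, fun y hy => ?_, ?_⟩
  · have : W.mkQ y = 0 := by simpa using hy
    change g (W.mkQ y) = 0
    rw [this, map_zero]
  · change g (W.mkQ z) ≠ 0
    rw [hg]
    simpa using hne

/-- A nonreflexive space with a nonzero M-projection whose bitranspose maps into the canonical copy
is not L-embedded. -/
theorem not_isLEmbedded_of_isMprojection {Q : Y →L[𝕜] Y} (hQ : IsMprojection Y Q) (hne : Q ≠ 0)
    (hr : ∀ z, Q.transpose.transpose z ∈ canonicalCopy 𝕜 Y) (htop : canonicalCopy 𝕜 Y ≠ ⊤) :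
    ¬ IsLEmbedded 𝕜 Y := by
  rintro ⟨P, hP, hPr⟩
  have hPi := ((isLprojection_iff P).1 hP).1
  have h1 : P = 1 := by
    refine hP.eq_one_of_range_le hQ.transpose.transpose (fun z => ?_)
      (Q.transpose.transpose_ne_zero (Q.transpose_ne_zero hne))
    obtain ⟨w, hw⟩ : Q.transpose.transpose z ∈ P.toLinearMap.range := hPr ▸ hr z
    rw [← hw]; exact hPi w
  apply htop
  rw [← hPr, h1, eq_top_iff]
  exact fun z _ => ⟨z, rfl⟩

/-- A nonreflexive Banach space with a nonzero L-projection whose bitranspose maps into the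
canonical copy is not M-embedded. -/
theorem not_isMEmbedded_of_isLprojection [CompleteSpace Y] {Q : Y →L[𝕜] Y}
    (hQ : IsLprojection Y Q) (hne : Q ≠ 0)
    (hr : ∀ z, Q.transpose.transpose z ∈ canonicalCopy 𝕜 Y) (htop : canonicalCopy 𝕜 Y ≠ ⊤) :
    ¬ IsMEmbedded 𝕜 Y := by
  rintro ⟨P, hP, hPr⟩
  have h0 : P = 0 := by
    refine hP.eq_zero_of_range_le_ker hQ.transpose.transpose.transpose (fun φ => ?_)
      (Q.transpose.transpose.transpose_ne_zero
        (Q.transpose.transpose_ne_zero (Q.transpose_ne_zero hne)))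
    have hφ : P φ ∈ StrongDual.polarSubmodule 𝕜 (canonicalCopy 𝕜 Y) := hPr ▸ ⟨φ, rfl⟩
    rw [StrongDual.mem_polarSubmodule] at hφ
    ext z
    exact hφ _ (hr z)
  obtain ⟨z, hz⟩ : ∃ z, z ∉ canonicalCopy 𝕜 Y := by
    by_contra! h; exact htop (eq_top_iff.2 fun z _ => h z)
  obtain ⟨φ, hφ, hφz⟩ := exists_dual_eq_zero_of_notMem _ isClosed_canonicalCopy hz
  have : φ ∈ P.toLinearMap.range := by
    rw [hPr, StrongDual.mem_polarSubmodule]; exact hφ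
  obtain ⟨ψ, rfl⟩ := this
  simp [h0] at hφz

/-- The bitranspose of an operator of rank one takes values in the canonical copy. -/
theorem transpose_transpose_smulRight_mem (p : StrongDual 𝕜 Y) (e : Y)
    (z : StrongDual 𝕜 (StrongDual 𝕜 Y)) :
    (p.smulRight e).transpose.transpose z ∈ canonicalCopy 𝕜 Y := by
  refine ⟨z p • e, ?_⟩
  ext f
  have : (p.smulRight e).transpose f = f e • p := by ext; simp [mul_comm]
  simp [this, mul_comm]

/-- A bounded sequence has a weak-star cluster point in the bidual; it takes the value `lim f (x n)`
at every functional `f` for which this limit exists. -/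
theorem exists_bidual_eq_of_tendsto (x : ℕ → Y) {C : ℝ} (hx : ∀ n, ‖x n‖ ≤ C) :
    ∃ z : StrongDual 𝕜 (StrongDual 𝕜 Y), ∀ (f : StrongDual 𝕜 Y) (c : 𝕜),
      Tendsto (fun n => f (x n)) atTop (𝓝 c) → z f = c := by
  let U : Ultrafilter ℕ := hyperfilter ℕ
  let g : ℕ → WeakDual 𝕜 (StrongDual 𝕜 Y) :=
    fun n => StrongDual.toWeakDual (NormedSpace.inclusionInDoubleDual 𝕜 Y (x n))
  obtain ⟨z, -, hz⟩ := (WeakDual.isCompact_closedBall (𝕜 := 𝕜)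
    (0 : StrongDual 𝕜 (StrongDual 𝕜 Y)) C).ultrafilter_le_nhds (U.map g) (by
      refine le_principal_iff.2 (Filter.mem_map.2 (Filter.univ_mem' fun n => ?_))
      simpa [g] using (NormedSpace.double_dual_bound 𝕜 Y (x n)).trans (hx n))
  refine ⟨WeakDual.toStrongDual z, fun f c hc => ?_⟩
  -- By Banach–Alaoglu, `z` is the weak-star limit along a free ultrafilter, so it takes every
  -- existing ordinary limit.
  have h1 : Tendsto (fun n => f (x n)) U (𝓝 (z f)) :=
    ((WeakDual.eval_continuous f).tendsto z).comp hz
  exact tendsto_nhds_unique h1 (hc.mono_left (by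
    rw [← Nat.cofinite_eq_atTop]; exact hyperfilter_le_cofinite))

end Bidual

/-! ### Adding a vector in front of a Schauder basis -/

section Bases

theorem hasSum_conditional_nat_iff {M : Type*} [AddCommMonoid M] [TopologicalSpace M] {f : ℕ → M}
    {a : M} : HasSum f a (SummationFilter.conditional ℕ) ↔
      Tendsto (fun n => ∑ i ∈ Finset.range n, f i) atTop (𝓝 a) := by
  rw [HasSum, SummationFilter.conditional_filter_eq_map_range, tendsto_map'_iff]
  rfl

variable {𝕜 Y Z : Type*} [NontriviallyNormedField 𝕜] [NormedAddCommGroup Y] [NormedSpace 𝕜 Y]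
  [NormedAddCommGroup Z] [NormedSpace 𝕜 Z]

/-- A Schauder basis of `Y = 𝕜 e ⊕ Z` from one of `Z`: the vector `e` is put in front. -/
def SchauderBasis.cons (b : SchauderBasis 𝕜 Z) (e : Y) (p : StrongDual 𝕜 Y) (j : Z →L[𝕜] Y)
    (q : Y →L[𝕜] Z) (hpe : p e = 1) (hpj : ∀ z, p (j z) = 0) (hqe : q e = 0)
    (hqj : ∀ z, q (j z) = z) (hs : ∀ y, p y • e + j (q y) = y) : SchauderBasis 𝕜 Y where
  basis n := Nat.casesOn n e fun k => j (b k)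
  coord n := Nat.casesOn n p fun k => (b.coord k).comp q
  ortho i k := by
    rcases i with _ | i <;> rcases k with _ | k
    · simp [hpe]
    · simp [hpj]
    · simp [hqe]
    · simp [hqj, b.ortho, Pi.single_apply]
  expansion y := by
    rw [hasSum_conditional_nat_iff, ← tendsto_add_atTop_iff_nat 1]
    simp only [Finset.sum_range_succ', ContinuousLinearMap.comp_apply]
    have h := hasSum_conditional_nat_iff.1 (b.expansion (q y))
    have h' := ((j.continuous.tendsto _).comp h).add_const (p y • e)
    rw [add_comm (j (q y)), hs] at h'
    refine h'.congr fun n => ?_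
    simp [map_sum]

end Bases

/-! ### Unit vector bases of `ℓ¹` and `c₀` -/

section SequenceSpaces

variable (𝕜 : Type*) [RCLike 𝕜]

/-- The unit vector basis of `ℓ¹`. -/
noncomputable def l1Basis : SchauderBasis 𝕜 (lp (fun _ : ℕ => 𝕜) 1) where
  basis n := lp.single 1 n 1
  coord n := lp.evalCLM 𝕜 (fun _ : ℕ => 𝕜) 1 n
  ortho i j := by
    change (lp.single 1 j (1 : 𝕜) : lp (fun _ : ℕ => 𝕜) 1) i = _
    rw [lp.coeFn_single]
    congr
  expansion x := by
    have h := (lp.hasSum_single (by simp) x).tendsto_sum_nat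
    refine hasSum_conditional_nat_iff.2 (h.congr fun n => Finset.sum_congr rfl fun i _ => ?_)
    rw [← lp.single_smul]
    congr 1
    exact (mul_one (x i)).symm

/-- The reindexing `g` serves the shifted tails `n ↦ m + n`. -/
theorem norm_sum_smul_l1Basis {ι : Type*} (s : Finset ι) {g : ι → ℕ}
    (hg : Function.Injective g) (β : ι → 𝕜) :
    ‖∑ i ∈ s, β i • l1Basis 𝕜 (g i)‖ = ∑ i ∈ s, ‖β i‖ := by
  have h := lp.norm_sum_single (p := 1) (E := fun _ : ℕ => 𝕜) (by simp) (Function.extend g β 0)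
    (s.map ⟨g, hg⟩)
  simp only [ENNReal.toReal_one, Real.rpow_one, Finset.sum_map, Function.Embedding.coeFn_mk,
    hg.extend_apply] at h
  rw [← h]
  congr 1
  refine Finset.sum_congr rfl fun i _ => ?_
  change β i • lp.single (E := fun _ : ℕ => 𝕜) 1 (g i) (1 : 𝕜) = _
  rw [← lp.single_smul, smul_eq_mul, mul_one]

open ZeroAtInfty

variable {𝕜}

theorem ZeroAtInftyContinuousMap.norm_apply_le {α : Type*} [TopologicalSpace α] (f : C₀(α, 𝕜))
    (x : α) : ‖f x‖ ≤ ‖f‖ :=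
  f.toBCF.norm_coe_le_norm x

theorem ZeroAtInftyContinuousMap.norm_le_of_forall {α : Type*} [TopologicalSpace α]
    (f : C₀(α, 𝕜)) {C : ℝ} (hC : 0 ≤ C) (h : ∀ x, ‖f x‖ ≤ C) : ‖f‖ ≤ C :=
  (BoundedContinuousFunction.norm_le (f := f.toBCF) hC).2 h

theorem ZeroAtInftyContinuousMap.sum_apply {α ι : Type*} [TopologicalSpace α] (s : Finset ι)
    (f : ι → C₀(α, 𝕜)) (x : α) : (∑ i ∈ s, f i) x = ∑ i ∈ s, f i x := by
  classical
  induction s using Finset.induction_on with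
  | empty => simp
  | insert a s ha ih => rw [Finset.sum_insert ha, Finset.sum_insert ha, add_apply, ih]

variable (𝕜)

/-- The unit vectors of `c₀`. -/
noncomputable def c0Single (n : ℕ) : C₀(ℕ, 𝕜) where
  toFun := Pi.single n (1 : 𝕜)
  continuous_toFun := continuous_of_discreteTopology
  zero_at_infty' := by
    rw [cocompact_eq_cofinite]
    refine tendsto_const_nhds.congr' ?_
    filter_upwards [(Set.finite_singleton n).compl_mem_cofinite] with k hk
    exact (Pi.single_eq_of_ne (M := fun _ : ℕ => 𝕜) hk 1).symm

theorem c0Single_apply (n k : ℕ) : c0Single 𝕜 n k = if k = n then 1 else 0 :=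
  Pi.single_apply n (1 : 𝕜) k

/-- The unit vector basis of `c₀`. -/
noncomputable def c0Basis : SchauderBasis 𝕜 C₀(ℕ, 𝕜) where
  basis := c0Single 𝕜
  coord n := LinearMap.mkContinuous
    { toFun := fun f => f n, map_add' := fun _ _ => rfl, map_smul' := fun _ _ => rfl } 1
    fun f => by simpa using f.norm_apply_le n
  ortho i j := by simp [c0Single_apply, Pi.single_apply]
  expansion x := by
    rw [hasSum_conditional_nat_iff, Metric.tendsto_atTop]
    intro ε hε
    have h0 : Tendsto x atTop (𝓝 0) := by
      have := x.zero_at_infty'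
      rwa [cocompact_eq_cofinite, Nat.cofinite_eq_atTop] at this
    obtain ⟨N, hN⟩ := Metric.tendsto_atTop.1 h0 (ε / 2) (half_pos hε)
    refine ⟨N, fun n hn => ?_⟩
    rw [dist_eq_norm]
    refine (ZeroAtInftyContinuousMap.norm_le_of_forall _ (half_pos hε).le fun k => ?_).trans_lt
      (half_lt_self hε)
    rw [ZeroAtInftyContinuousMap.sub_apply, ZeroAtInftyContinuousMap.sum_apply]
    simp only [LinearMap.mkContinuous_apply, LinearMap.coe_mk, AddHom.coe_mk,
      ZeroAtInftyContinuousMap.smul_apply, c0Single_apply, smul_eq_mul, mul_ite, mul_one, mul_zero,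
      Finset.sum_ite_eq, Finset.mem_range]
    split_ifs with h
    · simpa using (half_pos hε).le
    · simpa using (hN k (by omega)).le

theorem c0Basis_apply (n k : ℕ) : c0Basis 𝕜 n k = if k = n then 1 else 0 :=
  c0Single_apply 𝕜 n k

theorem norm_sum_smul_c0Basis_le (s : Finset ℕ) (β : ℕ → 𝕜) {C : ℝ} (hC : 0 ≤ C)
    (h : ∀ n ∈ s, ‖β n‖ ≤ C) : ‖∑ n ∈ s, β n • c0Basis 𝕜 n‖ ≤ C := by
  refine ZeroAtInftyContinuousMap.norm_le_of_forall _ hC fun k => ?_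
  rw [ZeroAtInftyContinuousMap.sum_apply]
  simp only [ZeroAtInftyContinuousMap.smul_apply, c0Basis_apply, smul_eq_mul, mul_ite, mul_one,
    mul_zero, Finset.sum_ite_eq]
  split_ifs with hk
  · exact h k hk
  · simpa using hC

theorem norm_le_norm_sum_smul_c0Basis (s : Finset ℕ) (β : ℕ → 𝕜) {n : ℕ} (hn : n ∈ s) :
    ‖β n‖ ≤ ‖∑ k ∈ s, β k • c0Basis 𝕜 k‖ := by
  have h := ZeroAtInftyContinuousMap.norm_apply_le (∑ k ∈ s, β k • c0Basis 𝕜 k) n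
  rw [ZeroAtInftyContinuousMap.sum_apply] at h
  simpa [c0Basis_apply, hn] using h

end SequenceSpaces

/-! ### The example `𝕜 ⊕_∞ ℓ¹` -/

section Examples

open ZeroAtInfty

variable (𝕜 : Type u) [RCLike 𝕜]

/-- The basis of `𝕜 ⊕_∞ ℓ¹` consisting of `(1, 0)` and the unit vectors of `ℓ¹`. -/
noncomputable def prodL1Basis : SchauderBasis 𝕜 (𝕜 × lp (fun _ : ℕ => 𝕜) 1) :=
  (l1Basis 𝕜).cons (1, 0) (ContinuousLinearMap.fst 𝕜 _ _) (ContinuousLinearMap.inr 𝕜 _ _)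
    (ContinuousLinearMap.snd 𝕜 _ _) rfl (fun _ => rfl) rfl (fun _ => rfl)
    fun y => by ext <;> simp

@[simp]
theorem prodL1Basis_zero : prodL1Basis 𝕜 0 = (1, 0) := rfl

@[simp]
theorem prodL1Basis_succ (n : ℕ) : prodL1Basis 𝕜 (n + 1) = (0, l1Basis 𝕜 n) := rfl

theorem sum_smul_prodL1Basis_succ {ι : Type*} (s : Finset ι) (g : ι → ℕ) (β : ι → 𝕜) :
    ∑ i ∈ s, β i • prodL1Basis 𝕜 (g i + 1) = (0, ∑ i ∈ s, β i • l1Basis 𝕜 (g i)) := by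
  have : ∀ i, β i • prodL1Basis 𝕜 (g i + 1) =
      ContinuousLinearMap.inr 𝕜 𝕜 (lp (fun _ : ℕ => 𝕜) 1) (β i • l1Basis 𝕜 (g i)) := fun i => by
    rw [map_smul]; rfl
  simp only [this, ← map_sum]
  rfl

theorem sum_range_smul_prodL1Basis (N : ℕ) (α : ℕ → 𝕜) :
    ∑ n ∈ Finset.range (N + 1), α n • prodL1Basis 𝕜 n =
      (α 0, ∑ n ∈ Finset.range N, α (n + 1) • l1Basis 𝕜 n) := by
  rw [Finset.sum_range_succ', sum_smul_prodL1Basis_succ 𝕜 _ (fun n => n) fun n => α (n + 1)]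
  ext <;> simp

theorem norm_l1Basis (n : ℕ) : ‖l1Basis 𝕜 n‖ = 1 := by
  simpa using norm_sum_smul_l1Basis 𝕜 {n} Function.injective_id fun _ => (1 : 𝕜)

theorem norm_prodL1Basis (n : ℕ) : ‖prodL1Basis 𝕜 n‖ = 1 := by
  rcases n with _ | n
  · simp [Prod.norm_def]
  · simp [Prod.norm_def, norm_l1Basis]

/-- It suffices to verify the estimates in the definition of `SpansL1AlmostIsometrically` for
partial sums. -/
theorem SpansL1AlmostIsometrically.of_sum_range {X : Type*} [NormedAddCommGroup X]
    [NormedSpace 𝕜 X] [CompleteSpace X] {x : ℕ → X} (h0 : ∀ n, x n ≠ 0) (hx : ∀ n, ‖x n‖ ≤ 1)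
    {δ : ℕ → ℝ} (hδ : ∀ m, δ m ∈ Set.Ico (0 : ℝ) 1) (hδ0 : Tendsto δ atTop (𝓝 0))
    (h : ∀ (α : ℕ → 𝕜) (m N : ℕ),
      (1 - δ m) * ∑ n ∈ Finset.range (N + 1), ‖α (m + n)‖ ≤
        ‖∑ n ∈ Finset.range (N + 1), α (m + n) • x (m + n)‖) :
    SpansL1AlmostIsometrically 𝕜 x := by
  refine ⟨h0, δ, hδ, hδ0, fun α hα m => ?_⟩
  have hle : ∀ n, ‖α n • x n‖ ≤ ‖α n‖ := fun n => by
    rw [norm_smul]; exact mul_le_of_le_one_right (norm_nonneg _) (hx n)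
  have hm : Summable fun n => ‖α (m + n)‖ := hα.comp_injective (add_right_injective m)
  have hs : Summable fun n => α (m + n) • x (m + n) := .of_norm_bounded hm fun n => hle _
  refine ⟨le_of_tendsto_of_tendsto'
    (((tendsto_add_atTop_iff_nat 1).2 hm.hasSum.tendsto_sum_nat).const_mul _)
    ((tendsto_add_atTop_iff_nat 1).2 hs.hasSum.tendsto_sum_nat).norm fun N => h α m N, ?_⟩
  exact tsum_of_norm_bounded hm.hasSum fun n => hle _

theorem isAlmostIsometricToL1_prod :
    IsAlmostIsometricToL1 𝕜 (𝕜 × lp (fun _ : ℕ => 𝕜) 1) := by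
  refine ⟨prodL1Basis 𝕜, .of_sum_range 𝕜
    (fun n => norm_ne_zero_iff.1 (by rw [norm_prodL1Basis]; exact one_ne_zero))
    (fun n => (norm_prodL1Basis 𝕜 n).le) (δ := fun m => if m = 0 then 1 / 2 else 0)
    (fun m => ?_) ?_ fun α m N => ?_⟩
  · by_cases h : m = 0 <;> norm_num [h]
  · refine tendsto_const_nhds.congr' ?_
    filter_upwards [eventually_ne_atTop 0] with m hm
    simp [hm]
  · rcases m with _ | m
    · simp only [zero_add]
      rw [sum_range_smul_prodL1Basis, Finset.sum_range_succ', Prod.norm_def,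
        norm_sum_smul_l1Basis 𝕜 _ (g := fun n => n) Function.injective_id]
      -- A maximum of two numbers is at least half their sum, whence `δ 0 = 1 / 2`; later tails lie
      -- in `ℓ¹` and need no loss.
      have h1 := le_max_left ‖α 0‖ (∑ i ∈ Finset.range N, ‖α (i + 1)‖)
      have h2 := le_max_right ‖α 0‖ (∑ i ∈ Finset.range N, ‖α (i + 1)‖)
      dsimp only
      rw [if_pos trivial]
      linarith
    · have e : ∀ n, prodL1Basis 𝕜 (m + 1 + n) = prodL1Basis 𝕜 (m + n + 1) := fun n => by
        rw [add_right_comm]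
      simp only [e]
      rw [sum_smul_prodL1Basis_succ 𝕜 _ (fun n => m + n), Prod.norm_def,
        norm_sum_smul_l1Basis 𝕜 _ (add_right_injective m)]
      simp

/-- A weak-star cluster point of the basis has all coordinates zero, yet the summation functional on
`ℓ¹` takes the value one there. -/
theorem canonicalCopy_prod_l1_ne_top :
    canonicalCopy 𝕜 (𝕜 × lp (fun _ : ℕ => 𝕜) 1) ≠ ⊤ := by
  intro htop
  obtain ⟨z, hz⟩ := exists_bidual_eq_of_tendsto (𝕜 := 𝕜) (prodL1Basis 𝕜)
    fun n => (norm_prodL1Basis 𝕜 n).le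
  obtain ⟨y, rfl⟩ : z ∈ canonicalCopy 𝕜 (𝕜 × lp (fun _ : ℕ => 𝕜) 1) := htop ▸ Submodule.mem_top
  have hcoord : ∀ i, (prodL1Basis 𝕜).coord i y = 0 := fun i => by
    refine hz ((prodL1Basis 𝕜).coord i) 0 (tendsto_const_nhds.congr' ?_)
    filter_upwards [eventually_ne_atTop i] with n hn
    simp [(prodL1Basis 𝕜).ortho, hn.symm]
  have hy : y = 0 := by
    have h := (prodL1Basis 𝕜).expansion y
    simp only [hcoord, zero_smul] at h
    exact h.unique hasSum_zero
  have h1 := hz ((lp.tsumCLM 𝕜 ℕ 𝕜).comp (ContinuousLinearMap.snd 𝕜 _ _)) 1 (by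
    refine tendsto_const_nhds.congr' ?_
    filter_upwards [eventually_ne_atTop 0] with n hn
    obtain ⟨n, rfl⟩ := Nat.exists_eq_succ_of_ne_zero hn
    change 1 = ∑' i, (lp.single (E := fun _ : ℕ => 𝕜) 1 n (1 : 𝕜)) i
    simp [tsum_pi_single])
  rw [hy] at h1
  simp at h1

theorem not_isLEmbedded_prod_l1 : ¬ IsLEmbedded 𝕜 (𝕜 × lp (fun _ : ℕ => 𝕜) 1) := by
  let e : 𝕜 × lp (fun _ : ℕ => 𝕜) 1 := (1, 0)
  let p : StrongDual 𝕜 (𝕜 × lp (fun _ : ℕ => 𝕜) 1) := ContinuousLinearMap.fst 𝕜 _ _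
  have hp : ∀ y, p.smulRight e y = (y.1, 0) := fun y => by
    change y.1 • e = _
    simp [e]
  refine not_isLEmbedded_of_isMprojection (Q := p.smulRight e)
    ((isMprojection_iff _).2 ⟨fun y => by simp [hp], fun y => ?_⟩) (fun h => ?_)
    (transpose_transpose_smulRight_mem p e) (canonicalCopy_prod_l1_ne_top 𝕜)
  · rw [hp]
    simp [Prod.norm_def]
  · have := congrArg Prod.fst (DFunLike.congr_fun h e)
    rw [hp] at this
    simp [e] at this

/-! ### The example `𝕜 ⊕₁ c₀` -/

/-- The space `𝕜 ⊕₁ c₀`. -/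
abbrev SumC0 : Type u := WithLp 1 (𝕜 × C₀(ℕ, 𝕜))

/-- The embedding of `c₀` into `𝕜 ⊕₁ c₀`. -/
noncomputable def SumC0.inr : C₀(ℕ, 𝕜) →L[𝕜] SumC0 𝕜 :=
  (WithLp.prodContinuousLinearEquiv 1 𝕜 𝕜 C₀(ℕ, 𝕜)).symm.toContinuousLinearMap.comp
    (ContinuousLinearMap.inr 𝕜 _ _)

theorem SumC0.inr_apply (z : C₀(ℕ, 𝕜)) : SumC0.inr 𝕜 z = WithLp.toLp 1 (0, z) := rfl

/-- The basis of `𝕜 ⊕₁ c₀` consisting of `(1/2, 0)` and the unit vectors of `c₀`. -/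
noncomputable def sumC0Basis : SchauderBasis 𝕜 (SumC0 𝕜) :=
  -- The factor `1 / 2` keeps `δ 0` below one: a unit vector in front would force the upper constant
  -- `2`, whereas `|α 0| / 2 + ‖v‖` lies between `1 / 2` and `3 / 2` times the supremum.
  (c0Basis 𝕜).cons (WithLp.toLp 1 (1 / 2, 0)) ((2 : 𝕜) • WithLp.fstL 1 𝕜 _ _) (SumC0.inr 𝕜)
    (WithLp.sndL 1 𝕜 _ _) (by simp) (fun _ => by simp [SumC0.inr_apply])
    (by simp) (fun _ => by simp [SumC0.inr_apply])
    fun y => by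
      apply WithLp.ofLp_injective
      ext <;> simp [SumC0.inr_apply]; ring

@[simp]
theorem sumC0Basis_zero : sumC0Basis 𝕜 0 = WithLp.toLp 1 (1 / 2, 0) := rfl

@[simp]
theorem sumC0Basis_succ (n : ℕ) : sumC0Basis 𝕜 (n + 1) = SumC0.inr 𝕜 (c0Basis 𝕜 n) := rfl

theorem sum_smul_sumC0Basis_succ (s : Finset ℕ) (β : ℕ → 𝕜) :
    ∑ n ∈ s, β n • sumC0Basis 𝕜 (n + 1) = WithLp.toLp 1 (0, ∑ n ∈ s, β n • c0Basis 𝕜 n) := by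
  rw [← SumC0.inr_apply, map_sum]
  simp

theorem sum_Icc_zero_smul_sumC0Basis (N : ℕ) (α : ℕ → 𝕜) :
    ∑ n ∈ Finset.Icc 0 N, α n • sumC0Basis 𝕜 n =
      WithLp.toLp 1 (α 0 / 2, ∑ n ∈ Finset.range N, α (n + 1) • c0Basis 𝕜 n) := by
  rw [← Nat.range_succ_eq_Icc_zero, Finset.sum_range_succ',
    sum_smul_sumC0Basis_succ 𝕜 _ fun n => α (n + 1)]
  apply WithLp.ofLp_injective
  ext <;> simp [div_eq_mul_inv]

theorem isAlmostIsometricToC0_sumC0 : IsAlmostIsometricToC0 𝕜 (SumC0 𝕜) := by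
  refine ⟨sumC0Basis 𝕜, fun n h => ?_, fun m => if m = 0 then 1 / 2 else 0, fun m => ?_, ?_,
    fun α m m' h => ?_⟩
  · have := (sumC0Basis 𝕜).ortho n n
    rw [show sumC0Basis 𝕜 n = 0 from h, map_zero] at this
    simp at this
  · by_cases h : m = 0 <;> norm_num [h]
  · refine tendsto_const_nhds.congr' ?_
    filter_upwards [eventually_ne_atTop 0] with m hm
    simp [hm]
  · set S := (Finset.Icc m m').sup' (Finset.nonempty_Icc.mpr h) (fun n => ‖α n‖) with hS
    have hSle : ∀ n ∈ Finset.Icc m m', ‖α n‖ ≤ S := fun n hn =>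
      Finset.le_sup' (fun n => ‖α n‖) hn
    have hS0 : 0 ≤ S := (norm_nonneg _).trans (hSle m (Finset.left_mem_Icc.2 h))
    rcases m with _ | m
    · rw [sum_Icc_zero_smul_sumC0Basis, WithLp.prod_norm_eq_of_L1]
      set v := ∑ n ∈ Finset.range m', α (n + 1) • c0Basis 𝕜 n with hv
      have e : ‖α 0 / 2‖ = ‖α 0‖ / 2 := by simp
      change _ * S ≤ ‖α 0 / 2‖ + ‖v‖ ∧ ‖α 0 / 2‖ + ‖v‖ ≤ _
      rw [e]
      have h1 : ‖v‖ ≤ S := norm_sum_smul_c0Basis_le 𝕜 _ (fun n => α (n + 1)) hS0 fun n hn =>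
        hSle _ (by simp at hn ⊢; omega)
      have h2 := hSle 0 (by simp)
      have h3 : S ≤ 2 * (‖α 0‖ / 2 + ‖v‖) := by
        refine Finset.sup'_le _ _ fun n hn => ?_
        rcases n with _ | n
        · linarith [norm_nonneg v]
        · have := norm_le_norm_sum_smul_c0Basis 𝕜 (Finset.range m') (fun n => α (n + 1)) (n := n)
            (by simp at hn ⊢; omega)
          linarith [norm_nonneg v, norm_nonneg (α 0)]
      norm_num
      constructor <;> linarith
    · obtain ⟨l, rfl⟩ := Nat.exists_eq_add_of_le' (Nat.one_le_of_lt h)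
      have e : ∑ n ∈ Finset.Icc (m + 1) (l + 1), α n • sumC0Basis 𝕜 n =
          ∑ n ∈ Finset.Icc m l, α (n + 1) • sumC0Basis 𝕜 (n + 1) := by
        rw [← Finset.map_add_right_Icc, Finset.sum_map]; rfl
      rw [e, sum_smul_sumC0Basis_succ 𝕜 _ fun n => α (n + 1), WithLp.prod_norm_eq_of_L1]
      simp only [Nat.add_eq_zero_iff, one_ne_zero, and_false, if_false, sub_zero, one_mul,
        add_zero]
      change S ≤ ‖(0 : 𝕜)‖ + ‖_‖ ∧ ‖(0 : 𝕜)‖ + ‖_‖ ≤ S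
      rw [norm_zero, zero_add]
      refine ⟨Finset.sup'_le _ _ fun n hn => ?_, ?_⟩
      · obtain ⟨n, rfl⟩ : ∃ k, n = k + 1 :=
          Nat.exists_eq_succ_of_ne_zero (by simp at hn; omega)
        exact norm_le_norm_sum_smul_c0Basis 𝕜 (Finset.Icc m l) (fun n => α (n + 1))
          (by simpa using hn)
      · exact norm_sum_smul_c0Basis_le 𝕜 (Finset.Icc m l) (fun n => α (n + 1)) hS0 fun n hn =>
          hSle _ (by simpa using hn)

/-- The partial sums of the unit vectors of `c₀` are bounded, and a weak-star cluster point has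
every `c₀` coordinate equal to one, so it cannot come from a null sequence. -/
theorem canonicalCopy_sumC0_ne_top : canonicalCopy 𝕜 (SumC0 𝕜) ≠ ⊤ := by
  intro htop
  obtain ⟨z, hz⟩ := exists_bidual_eq_of_tendsto (𝕜 := 𝕜) (Y := SumC0 𝕜) (C := 1)
    (fun N => SumC0.inr 𝕜 (∑ n ∈ Finset.range N, (1 : 𝕜) • c0Basis 𝕜 n)) fun N => by
      rw [SumC0.inr_apply, WithLp.prod_norm_eq_of_L1]
      simpa using norm_sum_smul_c0Basis_le 𝕜 (Finset.range N) (fun _ => 1) zero_le_one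
  obtain ⟨y, rfl⟩ : z ∈ canonicalCopy 𝕜 (SumC0 𝕜) := htop ▸ Submodule.mem_top
  have hcoord : ∀ i, y.snd i = 1 := fun i => by
    refine hz (((c0Basis 𝕜).coord i).comp (WithLp.sndL 1 𝕜 _ _)) 1 (tendsto_const_nhds.congr' ?_)
    filter_upwards [eventually_gt_atTop i] with n hn
    change 1 = (∑ n ∈ Finset.range n, (1 : 𝕜) • c0Basis 𝕜 n) i
    rw [ZeroAtInftyContinuousMap.sum_apply]
    simp [c0Basis_apply, hn]
  have h0 := y.snd.zero_at_infty'
  rw [cocompact_eq_cofinite, Nat.cofinite_eq_atTop] at h0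
  have h1 : Tendsto (fun _ : ℕ => (1 : 𝕜)) atTop (𝓝 0) := h0.congr hcoord
  exact one_ne_zero (tendsto_nhds_unique tendsto_const_nhds h1)

theorem not_isMEmbedded_sumC0 : ¬ IsMEmbedded 𝕜 (SumC0 𝕜) := by
  let e : SumC0 𝕜 := WithLp.toLp 1 (1, 0)
  let p : StrongDual 𝕜 (SumC0 𝕜) := WithLp.fstL 1 𝕜 _ _
  have hp : ∀ y, p.smulRight e y = WithLp.toLp 1 (y.fst, 0) := fun y => by
    change y.fst • e = _
    apply WithLp.ofLp_injective
    ext <;> simp [e]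
  refine not_isMEmbedded_of_isLprojection (Q := p.smulRight e)
    ((isLprojection_iff _).2 ⟨fun y => by simp [hp], fun y => ?_⟩) (fun h => ?_)
    (transpose_transpose_smulRight_mem p e) (canonicalCopy_sumC0_ne_top 𝕜)
  · rw [hp]
    simp [WithLp.prod_norm_eq_of_L1]
  · have := congrArg WithLp.fst (DFunLike.congr_fun h e)
    rw [hp] at this
    simp [e] at this

end Examples

theorem mainTheorem6 (𝕜 : Type u) [RCLike 𝕜] :
    (∃ (Y : Type u) (_ : NormedAddCommGroup Y) (_ : NormedSpace 𝕜 Y) (_ : CompleteSpace Y),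
      IsAlmostIsometricToL1 𝕜 Y ∧ ¬ IsLEmbedded 𝕜 Y) ∧
    (∃ (Y : Type u) (_ : NormedAddCommGroup Y) (_ : NormedSpace 𝕜 Y) (_ : CompleteSpace Y),
      IsAlmostIsometricToC0 𝕜 Y ∧ ¬ IsMEmbedded 𝕜 Y) :=
  ⟨⟨𝕜 × lp (fun _ : ℕ => 𝕜) 1, inferInstance, inferInstance, inferInstance,
    isAlmostIsometricToL1_prod 𝕜, not_isLEmbedded_prod_l1 𝕜⟩,
    ⟨SumC0 𝕜, inferInstance, inferInstance, inferInstance,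
      isAlmostIsometricToC0_sumC0 𝕜, not_isMEmbedded_sumC0 𝕜⟩⟩
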